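/- A hypergraph is a pair $(V,E)$ with $E$ a set of subsets of $V$. A $k$-coloring of $V$ is polychromatic if every hyperedge contains a vertex of each of the $k$ colors. For a hypergraph $H$ let $H_{\ge m}$ be obtained from $H$ by deleting all hyperedges with fewer than $m$ vertices. For a family $\mathcal H$ of hypergraphs let $m_{\mathcal H}(k)$ be the smallest positive integer $m$ such that $H_{\ge m}$ has a polychromatic $k$-coloring for every $H\in\mathcal H$, and $m_{\mathcal H}(k)=\infty$ if there is no such $m$. Let $\mathcal B$ be the family of hypergraphs $(V,E)$ with $V\subset\mathbb R^2$ finite such that every $e\in E$ is of the form $e=\{(x,y)\in V: x_0<x<x_1,\ y<y_0\}$ with $x_0,x_1,y_0\in\mathbb R$ (bottomless rectangles). With $\mathbb N=\{0,1,2,\dots\}$ and $D,M\subseteq\mathbb N$, let $\mathcal A_{D,M}$ be the family of hypergraphs $(S,E)$ with $S\subset\mathbb N$ finite such that every $e\in E$ is of the form $e=S\cap\{a,a+d,\dots,a+(n-1)d\}$ with $a\in\mathbb N$, $n\ge 1$, $d\in D$, where $a-md\in M$ for some $m\in\mathbb N$. Write $m_{D,M}(k)=m_{\mathcal A_{D,M}}(k)$.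 (1) Let $t\ge 1$ and $k\ge 1$ be integers, and suppose that $M\subseteq\mathbb N$ contains at most one element of every residue class modulo $t$. Then \[ m_{\{t^i:\, i\in\mathbb N\},\,M}(k)\le |M|\,(m_{\mathcal B}(k)-1)+1 . \] Here $0\cdot\infty=0$. (2) Let $p,q\ge 2$ be coprime integers and let $k\ge 2$. Then \[ m_{\{p^iq^j:\, i,j\in\mathbb N\},\,\{0\}}(k)=\infty . \] -/

import Mathlib

namespace Polychromatic

/-- The hypergraph `H_{≥ m}`: all hyperedges of size smaller than `m` are deleted. -/
def atLeast {α : Type*} (H : Hypergraph α) (m : ℕ) : Hypergraph α where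
  vertexSet := H.vertexSet
  edgeSet := {e | e ∈ H.edgeSet ∧ (m : ℕ∞) ≤ e.encard}
  subset_vertexSet_of_mem_edgeSet' := fun _ he => H.subset_vertexSet_of_mem_edgeSet' he.1

/-- A colouring of the vertices with `k` colours is polychromatic if every hyperedge contains
a vertex of each of the `k` colours. -/
def IsPolychromatic {α : Type*} (H : Hypergraph α) (k : ℕ) (c : H.vertexSet → Fin k) : Prop :=
  ∀ e ∈ H.edgeSet, ∀ i : Fin k, ∃ v : H.vertexSet, (v : α) ∈ e ∧ c v = i

/-- The parameter `m_𝓗(k)`: the smallest positive integer `m` such that for every `H ∈ 𝓗` the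
hypergraph `H_{≥ m}` has a polychromatic `k`-colouring, and `∞` if there is no such `m`. -/
noncomputable def mParam {α : Type*} (𝓗 : Set (Hypergraph α)) (k : ℕ) : ℕ∞ :=
  sInf {x : ℕ∞ | ∃ m : ℕ, x = m ∧ 0 < m ∧
    ∀ H ∈ 𝓗, ∃ c : (atLeast H m).vertexSet → Fin k, IsPolychromatic (atLeast H m) k c}

/-- The family `𝓑` of hypergraphs on finite vertex sets in the plane all of whose edges are
captured by bottomless rectangles. -/
def bottomless : Set (Hypergraph (ℝ × ℝ)) :=
  {H | H.vertexSet.Finite ∧ ∀ e ∈ H.edgeSet, ∃ x₀ x₁ y₀ : ℝ,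
    e = {P | P ∈ H.vertexSet ∧ x₀ < P.1 ∧ P.1 < x₁ ∧ P.2 < y₀}}

/-- The finite arithmetic progressions `a, a + d, …, a + (n - 1) d` (with `n ≥ 1`) of difference
`d ∈ D` such that `a - m d ∈ M` for some natural number `m`. -/
def finiteProgressions (D M : Set ℕ) : Set (Set ℕ) :=
  {P | ∃ a d n : ℕ, d ∈ D ∧ 0 < n ∧ (∃ m : ℕ, ∃ μ ∈ M, (a : ℤ) - m * d = μ) ∧
    P = {x | ∃ j < n, x = a + j * d}}

/-- The family `𝓐_{D,M}` of hypergraphs on finite sets of natural numbers all of whose edges are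
traces of progressions from `finiteProgressions D M`. -/
def apFamily (D M : Set ℕ) : Set (Hypergraph ℕ) :=
  {A | A.vertexSet.Finite ∧ ∀ e ∈ A.edgeSet, ∃ P ∈ finiteProgressions D M, e = P ∩ A.vertexSet}

end Polychromatic

/-!
The upper bound for the powers of a single base `t` comes from drawing numbers as points of the
plane. For `u ∈ M`, place `x` at height decreasing in the `t`-adic valuation of `x - u`. The numbers
`x ≡ u` modulo `t ^ i` in an interval are then the points of a bottomless rectangle. Divide the
vertices among the `u ∈ M`, such that those congruent to some `u` modulo `t` go to that `u`, and
colour the parts separately by polychromatic colourings of bottomless hypergraphs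
(`exists_coloring_class`). A progression of difference `t ^ i` with `i ≥ 1` lies in one part.
A progression of difference `1` is an interval, which may meet all the parts; if it has more than
`|M| (m - 1)` vertices, then `m` of them are in the same part by the pigeonhole principle.

For two coprime bases `p` and `q`, numbers with arbitrary prescribed valuations at `p` and `q` can
be placed in any order. The edges thus include all intervals in this order and all quadrants in the
plane of the two valuations. These realize the siblings and the root-to-leaf paths of an `m`-ary
forest of depth `m` (`exists_forest`): siblings are consecutive in the order, and lie on an
antidiagonal in the plane of valuations, with the descendants of each node close to it, slightly
lower and to the left. Any two-colouring has a monochromatic edge: if siblings always have both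
colours, then a path of a given colour descends from the roots to the leaves.
-/

namespace Polychromatic

/-! ### Progressions to the powers of one base -/

/-- The height function sending a valuation `v ∈ ℕ∞` to `1 / (v + 1)`, and `∞` to `0`: large
valuations lie low, so that a bottomless rectangle can cut out the multiples of a power. -/
noncomputable def height : ℕ∞ → ℝ
  | ⊤ => 0
  | (n : ℕ) => 1 / (n + 1)

theorem height_lt_iff (v : ℕ∞) (i : ℕ) : height v < 1 / (i + 1 / 2) ↔ (i : ℕ∞) ≤ v := by
  cases v with
  | top =>
    simp only [height, le_top, iff_true]
    positivity
  | coe n =>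
    simp only [height, Nat.cast_le]
    rw [one_div_lt_one_div (by positivity) (by positivity)]
    constructor
    · intro h
      by_contra! hn
      have : (n : ℝ) + 1 ≤ i := by exact_mod_cast hn
      linarith
    · intro h
      have : (i : ℝ) ≤ n := by exact_mod_cast h
      linarith

/-- The hypergraph on a vertex set `V` in the plane whose edges are all the traces of bottomless
rectangles. -/
def bottomlessOn (V : Set (ℝ × ℝ)) : Hypergraph (ℝ × ℝ) where
  vertexSet := V
  edgeSet := {e | ∃ x₀ x₁ y₀ : ℝ, e = {P | P ∈ V ∧ x₀ < P.1 ∧ P.1 < x₁ ∧ P.2 < y₀}}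
  subset_vertexSet_of_mem_edgeSet' := by
    rintro e ⟨x₀, x₁, y₀, rfl⟩ P hP
    exact hP.1

theorem bottomlessOn_mem {V : Set (ℝ × ℝ)} (hV : V.Finite) : bottomlessOn V ∈ bottomless :=
  ⟨hV, fun _ he => he⟩

/-- If large bottomless edges can be polychromatically coloured, then so can the large traces on a
finite `S ⊆ ℕ` of intervals, and of the multiples of a `t ^ i`, shifted by `u`, in an interval:
place `x` at height `height (v_t (x - u))`. -/
theorem exists_coloring_class {m k : ℕ}
    (hm : ∀ H ∈ bottomless, ∃ c : (atLeast H m).vertexSet → Fin k,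
      IsPolychromatic (atLeast H m) k c)
    (t u : ℕ) {S : Set ℕ} (hS : S.Finite) :
    ∃ c : S → Fin k, ∀ a b i : ℕ,
      (m : ℕ∞) ≤ {x | x ∈ S ∧ a ≤ x ∧ x < b ∧ (t : ℤ) ^ i ∣ x - u}.encard →
      ∀ l : Fin k, ∃ v : S, (a ≤ v.1 ∧ v.1 < b ∧ (t : ℤ) ^ i ∣ v.1 - u) ∧ c v = l := by
  let g : ℕ → ℝ × ℝ := fun x => (x, height (emultiplicity (t : ℤ) ((x : ℤ) - u)))
  have hg : Function.Injective g := fun x y h => by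
    have : (x : ℝ) = y := congrArg Prod.fst h
    exact_mod_cast this
  obtain ⟨c, hc⟩ := hm _ (bottomlessOn_mem (hS.image g))
  refine ⟨fun v => c ⟨g v, Set.mem_image_of_mem g v.2⟩, fun a b i hcard l => ?_⟩
  -- The real numbers strictly between `a - 1 / 2` and `b - 1 / 2` are cut at half-integers.
  have key : ∀ x : ℕ, ((a : ℝ) - 1 / 2 < (g x).1 ∧ (g x).1 < (b : ℝ) - 1 / 2 ∧
      (g x).2 < 1 / (i + 1 / 2)) ↔ (a ≤ x ∧ x < b ∧ (t : ℤ) ^ i ∣ x - u) := by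
    intro x
    simp only [g, height_lt_iff, pow_dvd_iff_le_emultiplicity]
    refine and_congr ?_ (and_congr ?_ Iff.rfl)
    · constructor
      · intro h
        by_contra! hn
        have : (x : ℝ) + 1 ≤ a := by exact_mod_cast hn
        linarith
      · intro h
        have : (a : ℝ) ≤ x := by exact_mod_cast h
        linarith
    · constructor
      · intro h
        by_contra! hn
        have : (b : ℝ) ≤ x := by exact_mod_cast hn
        linarith
      · intro h
        have : (x : ℝ) + 1 ≤ b := by exact_mod_cast h
        linarith
  have himg : {P | P ∈ g '' S ∧ (a : ℝ) - 1 / 2 < P.1 ∧ P.1 < (b : ℝ) - 1 / 2 ∧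
      P.2 < 1 / ((i : ℝ) + 1 / 2)} = g '' {x | x ∈ S ∧ a ≤ x ∧ x < b ∧ (t : ℤ) ^ i ∣ x - u} := by
    ext P
    constructor
    · rintro ⟨⟨x, hx, rfl⟩, h⟩
      exact ⟨x, ⟨hx, (key x).1 h⟩, rfl⟩
    · rintro ⟨x, ⟨hx, h⟩, rfl⟩
      exact ⟨⟨x, hx, rfl⟩, (key x).2 h⟩
  obtain ⟨⟨P, hP⟩, hPe, hPc⟩ := hc _ ⟨⟨_, _, _, rfl⟩, by
    rw [himg, hg.encard_image]; exact hcard⟩ l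
  obtain ⟨x, hx, rfl⟩ := hP
  exact ⟨⟨x, hx⟩, (key x).1 hPe.2, hPc⟩

/-- The parameter is attained if it is finite. -/
theorem exists_of_mParam_ne_top {α : Type*} {𝓗 : Set (Hypergraph α)} {k : ℕ}
    (h : mParam 𝓗 k ≠ ⊤) : ∃ m : ℕ, mParam 𝓗 k = m ∧ 0 < m ∧
      ∀ H ∈ 𝓗, ∃ c : (atLeast H m).vertexSet → Fin k, IsPolychromatic (atLeast H m) k c := by
  have hne : {x : ℕ∞ | ∃ m : ℕ, x = m ∧ 0 < m ∧
      ∀ H ∈ 𝓗, ∃ c : (atLeast H m).vertexSet → Fin k,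
        IsPolychromatic (atLeast H m) k c}.Nonempty := by
    by_contra hn
    rw [Set.not_nonempty_iff_eq_empty] at hn
    exact h (by rw [mParam, hn, sInf_empty])
  exact csInf_mem hne

theorem mParam_le {α : Type*} {𝓗 : Set (Hypergraph α)} {k m : ℕ} (hm : 0 < m)
    (h : ∀ H ∈ 𝓗, ∃ c : (atLeast H m).vertexSet → Fin k, IsPolychromatic (atLeast H m) k c) :
    mParam 𝓗 k ≤ m :=
  sInf_le ⟨m, rfl, hm, h⟩

/-- A set with more than `n * l` elements meets some fibre of a map to an `n`-element set in more
than `l` elements. -/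
theorem exists_le_encard_fiber {α β : Type*} {M : Finset β} {e : Set α} (f : α → β)
    (hf : ∀ x ∈ e, f x ∈ M) {l : ℕ} (he : ((M.card * l + 1 : ℕ) : ℕ∞) ≤ e.encard) :
    ∃ u ∈ M, ((l + 1 : ℕ) : ℕ∞) ≤ {x | x ∈ e ∧ f x = u}.encard := by
  classical
  obtain ⟨s, hse, hs⟩ := Set.exists_subset_encard_eq he
  have hfin : s.Finite := Set.finite_of_encard_eq_coe hs
  lift s to Finset α using hfin
  rw [Set.encard_coe_eq_coe_finsetCard, Nat.cast_inj] at hs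
  obtain ⟨u, hu, hlt⟩ := Finset.exists_lt_card_fiber_of_mul_lt_card_of_maps_to
    (s := s) (t := M) (f := f) (n := l) (fun x hx => hf x (hse hx)) (by omega)
  refine ⟨u, hu, ?_⟩
  calc ((l + 1 : ℕ) : ℕ∞) ≤ ((s.filter (f · = u)).card : ℕ∞) := by exact_mod_cast hlt
    _ = ((s.filter (f · = u) : Finset α) : Set α).encard :=
      (Set.encard_coe_eq_coe_finsetCard _).symm
    _ ≤ _ := Set.encard_le_encard fun x hx => by
      simp only [Finset.coe_filter, Set.mem_ofPred_eq] at hx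
      exact ⟨hse hx.1, hx.2⟩

theorem mParam_apFamily_le {t k : ℕ} {M : Set ℕ} (ht : 0 < t) (hk : 0 < k)
    (hM : ∀ a ∈ M, ∀ b ∈ M, a ≡ b [MOD t] → a = b) :
    mParam (apFamily {d | ∃ i : ℕ, d = t ^ i} M) k ≤
      M.encard * (mParam bottomless k - 1) + 1 := by
  classical
  rcases M.eq_empty_or_nonempty with rfl | ⟨u₀, hu₀⟩
  · rw [Set.encard_empty, zero_mul, zero_add]
    refine mParam_le (m := 1) one_pos fun H hH => ⟨fun _ => ⟨0, hk⟩, fun e he => ?_⟩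
    obtain ⟨P, ⟨a, d, n, -, -, ⟨_, _, h, _⟩, -⟩, -⟩ := hH.2 e he.1
    exact absurd h (Set.notMem_empty _)
  by_cases htop : mParam bottomless k = ⊤
  · have : M.encard * ((⊤ : ℕ∞) - 1) + 1 = ⊤ := by
      rw [show (⊤ : ℕ∞) - 1 = ⊤ from rfl, ENat.mul_top
        (Set.encard_ne_zero.2 ⟨u₀, hu₀⟩), top_add]
    rw [htop, this]
    exact le_top
  have hfin : M.Finite :=
    Set.Finite.of_finite_image ((Set.finite_lt_nat t).subset
      (Set.image_subset_iff.2 fun x _ => Nat.mod_lt x ht)) (f := fun x => x % t)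
      fun a ha b hb h => hM a ha b hb h
  lift M to Finset ℕ using hfin
  obtain ⟨m, hmB, hm0, hm⟩ := exists_of_mParam_ne_top htop
  rw [hmB, Set.encard_coe_eq_coe_finsetCard]
  obtain ⟨l, rfl⟩ : ∃ l, m = l + 1 := ⟨m - 1, by omega⟩
  have hcast : (M.card : ℕ∞) * (((l + 1 : ℕ) : ℕ∞) - 1) + 1 = ((M.card * l + 1 : ℕ) : ℕ∞) := by
    have h : ((l + 1 : ℕ) : ℕ∞) - 1 = l := rfl
    rw [h]
    push_cast
    rfl
  rw [hcast]
  refine mParam_le (Nat.succ_pos _) fun H hH => ?_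
  -- Each `x` is sent to the element of `M` in its residue class, to `u₀` if there is none.
  let r : ℕ → ℕ := fun x => if h : ∃ u ∈ M, u ≡ x [MOD t] then h.choose else u₀
  have hrM : ∀ x, r x ∈ M := fun x => by
    by_cases h : ∃ u ∈ M, u ≡ x [MOD t]
    · simpa only [r, dif_pos h] using h.choose_spec.1
    · simpa only [r, dif_neg h, Finset.mem_coe] using hu₀
  have hr : ∀ u ∈ M, ∀ x, u ≡ x [MOD t] → r x = u := fun u hu x hx => by
    have h : ∃ u ∈ M, u ≡ x [MOD t] := ⟨u, hu, hx⟩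
    simp only [r, dif_pos h]
    exact hM _ h.choose_spec.1 _ hu (h.choose_spec.2.trans hx.symm)
  choose c hc using fun u => exists_coloring_class hm t u
    (hH.1.subset (fun x hx => hx.1 : {x | x ∈ H.vertexSet ∧ r x = u} ⊆ H.vertexSet))
  refine ⟨fun v => c (r v) ⟨v, v.2, rfl⟩, ?_⟩
  rintro e ⟨he, hcard⟩ col
  obtain ⟨P, ⟨a, d, n, ⟨i, rfl⟩, hn, ⟨s, u, hu, ha⟩, rfl⟩, rfl⟩ := hH.2 e he
  have ha' : a = u + s * t ^ i := by
    have : (a : ℤ) = u + s * t ^ i := by push_cast at ha; linarith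
    exact_mod_cast this
  have hP : ∀ x : ℕ, (∃ j < n, x = a + j * t ^ i) ↔
      a ≤ x ∧ x < a + n * t ^ i ∧ (t : ℤ) ^ i ∣ x - u := by
    intro x
    constructor
    · rintro ⟨j, hj, rfl⟩
      refine ⟨by omega, ?_, ?_⟩
      · have := Nat.mul_lt_mul_of_pos_right hj (pow_pos ht i)
        omega
      · exact ⟨s + j, by rw [ha']; push_cast; ring⟩
    · rintro ⟨h1, h2, h3⟩
      obtain ⟨w, rfl⟩ := Nat.exists_eq_add_of_le h1
      have h4 : t ^ i ∣ w := by
        have : (t : ℤ) ^ i ∣ w := by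
          have h5 : ((a + w : ℕ) : ℤ) - u = s * t ^ i + w := by rw [ha']; push_cast; ring
          rw [h5] at h3
          exact (dvd_add_right (Dvd.intro_left _ rfl)).1 h3
        exact_mod_cast this
      obtain ⟨j, rfl⟩ := h4
      refine ⟨j, ?_, by ring⟩
      by_contra! hj
      have := Nat.mul_le_mul_right (t ^ i) hj
      rw [mul_comm j] at this
      omega
  -- A fibre of `r` with a large part of the edge, in which the edge is captured by a rectangle.
  obtain ⟨u', hlarge, hsub⟩ : ∃ u', ((l + 1 : ℕ) : ℕ∞) ≤
      {x | x ∈ {x | x ∈ H.vertexSet ∧ r x = u'} ∧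
        a ≤ x ∧ x < a + n * t ^ i ∧ (t : ℤ) ^ i ∣ x - u'}.encard ∧
      ((t : ℤ) ^ i ∣ (u' : ℤ) - u) := by
    obtain rfl | hi := Nat.eq_zero_or_pos i
    · obtain ⟨u', -, h⟩ := exists_le_encard_fiber r (fun x _ => hrM x) hcard
      refine ⟨u', h.trans (Set.encard_le_encard ?_), by simp⟩
      rintro x ⟨⟨hx, hxS⟩, hxr⟩
      exact ⟨⟨hxS, hxr⟩, ((hP x).1 hx).1, ((hP x).1 hx).2.1, by simp⟩
    · refine ⟨u, le_trans (le_trans ?_ hcard) (Set.encard_le_encard ?_), by simp⟩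
      · have : 1 * l ≤ M.card * l := Nat.mul_le_mul_right l (Finset.card_pos.2 ⟨u, hu⟩)
        exact_mod_cast (by omega : l + 1 ≤ M.card * l + 1)
      · rintro x ⟨hx, hxS⟩
        refine ⟨⟨hxS, hr u hu x ?_⟩, (hP x).1 hx⟩
        rw [Nat.modEq_iff_dvd]
        exact (dvd_pow_self (t : ℤ) hi.ne').trans ((hP x).1 hx).2.2
  obtain ⟨⟨x, hxS, rfl⟩, hx, hxc⟩ := hc u' _ _ _ hlarge col
  refine ⟨⟨x, hxS⟩, ⟨(hP x).2 ⟨hx.1, hx.2.1, ?_⟩, hxS⟩, hxc⟩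
  have := dvd_add hx.2.2 hsub
  simpa using this

/-! ### Progressions to the products of powers of two bases -/

/-- Some strip `{a ≤ x < b}` has at least `m` points, all of the same colour. -/
def HasMonoStrip {V : Type} (x : V → ℕ) (m : ℕ) (c : V → Bool) : Prop :=
  ∃ a b : ℕ, (m : ℕ∞) ≤ {v | a ≤ x v ∧ x v < b}.encard ∧
    ∃ col, ∀ v, a ≤ x v → x v < b → c v = col

/-- Some quadrant `{y ≥ i, z ≥ j}` with `i, j ≤ K` has at least `n` points, all of colour `col`. -/
def HasMonoQuadrant {V : Type} (y z : V → ℕ) (K n : ℕ) (c : V → Bool) (col : Bool) : Prop :=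
  ∃ i j : ℕ, i ≤ K ∧ j ≤ K ∧ (n : ℕ∞) ≤ {v | i ≤ y v ∧ j ≤ z v}.encard ∧
    ∀ v, i ≤ y v → j ≤ z v → c v = col

theorem le_of_mul_add_le_mul_add {N j j' r r' : ℕ} (hr' : r' < N)
    (h : j * N + r ≤ j' * N + r') : j ≤ j' := by
  by_contra! hj
  have := Nat.mul_le_mul_right N (Nat.succ_le_of_lt hj)
  rw [Nat.succ_mul] at this
  omega

theorem mul_add_lt_mul {N j m r : ℕ} (hj : j < m) (hr : r < N) : j * N + r < m * N := by
  have := Nat.mul_le_mul_right N (Nat.succ_le_of_lt hj)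
  rw [Nat.succ_mul] at this
  omega

/-- The points are the nodes of a forest of depth `n` in which each node that is not a leaf has `m`
children, and there are `m` roots. Siblings are consecutive in the order of `x`, and the quadrant
spanned by a node consists of the node and its ancestors. If the siblings are never monochromatic,
one can descend from the roots along nodes of any prescribed colour. -/
theorem exists_forest {m : ℕ} (hm : 0 < m) (n : ℕ) :
    ∃ (V : Type) (_ : Finite V) (x y z : V → ℕ) (K : ℕ), Function.Injective x ∧
      (∀ v, x v < K ∧ y v < K ∧ z v < K) ∧
      ∀ c : V → Bool, HasMonoStrip x m c ∨ ∀ col, HasMonoQuadrant y z K n c col := by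
  induction n with
  | zero =>
    exact ⟨Empty, inferInstance, Empty.elim, Empty.elim, Empty.elim, 0, fun v => v.elim,
      fun v => v.elim, fun c => Or.inr fun col => ⟨0, 0, le_rfl, le_rfl, by simp, fun v => v.elim⟩⟩
  | succ n ih =>
    obtain ⟨V, hV, x, y, z, K, hinj, hlt, hcol⟩ := ih
    -- Below root `j` a copy of the smaller forest is placed, with the coordinates `y` and `z` in
    -- the `j`-th window of length `K + 1`, counted upwards for `y` and downwards for `z`.
    let x' : Fin m ⊕ Fin m × V → ℕ := Sum.elim (fun j => j) (fun w => m + (w.1 * K + x w.2))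
    let y' : Fin m ⊕ Fin m × V → ℕ :=
      Sum.elim (fun j => j * (K + 1) + K) (fun w => w.1 * (K + 1) + y w.2)
    let z' : Fin m ⊕ Fin m × V → ℕ :=
      Sum.elim (fun j => (m - 1 - j) * (K + 1) + K) (fun w => (m - 1 - w.1) * (K + 1) + z w.2)
    have hlo : ∀ w : Fin m ⊕ Fin m × V, x' w < m + m * (K + 1) ∧ y' w < m + m * (K + 1) ∧
        z' w < m + m * (K + 1) := by
      rintro (j | ⟨j, v⟩)
      · have h1 := mul_add_lt_mul j.2 (Nat.lt_add_one K)
        have h2 := mul_add_lt_mul (show m - 1 - (j : ℕ) < m by omega) (Nat.lt_add_one K)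
        have h3 := j.2
        simp only [x', y', z', Sum.elim_inl]
        omega
      · obtain ⟨hx, hy, hz⟩ := hlt v
        have h1 := mul_add_lt_mul j.2 (hy.trans (Nat.lt_add_one K))
        have h2 := mul_add_lt_mul (show m - 1 - (j : ℕ) < m by omega)
          (hz.trans (Nat.lt_add_one K))
        have h3 := mul_add_lt_mul j.2 hx
        have h4 : m * K ≤ m * (K + 1) := Nat.mul_le_mul_left m (Nat.le_succ K)
        simp only [x', y', z', Sum.elim_inr]
        omega
    refine ⟨Fin m ⊕ Fin m × V, inferInstance, x', y', z', m + m * (K + 1), ?_, hlo, ?_⟩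
    · rintro (j | ⟨j, v⟩) (j' | ⟨j', v'⟩) h
      · exact congrArg Sum.inl (Fin.ext h)
      · have := j.2
        simp only [x', Sum.elim_inl, Sum.elim_inr] at h
        omega
      · have := j'.2
        simp only [x', Sum.elim_inl, Sum.elim_inr] at h
        omega
      · simp only [x', Sum.elim_inr] at h
        have hj : j = j' := Fin.ext (le_antisymm
          (le_of_mul_add_le_mul_add (hlt v').1 (by omega : (j : ℕ) * K + x v ≤ j' * K + x v'))
          (le_of_mul_add_le_mul_add (hlt v).1 (by omega : (j' : ℕ) * K + x v' ≤ j * K + x v)))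
        subst hj
        rw [hinj (by omega : x v = x v')]
    intro c
    by_cases hstrip : HasMonoStrip x' m c
    · exact Or.inl hstrip
    refine Or.inr fun col => ?_
    -- The roots form a strip, so that one of them has colour `col`.
    obtain ⟨j, hj⟩ : ∃ j : Fin m, c (Sum.inl j) = col := by
      by_contra! hne
      refine hstrip ⟨0, m, ?_, !col, ?_⟩
      · calc (m : ℕ∞) = (Set.range (Sum.inl : Fin m → Fin m ⊕ Fin m × V)).encard := by
              rw [← Set.image_univ, Sum.inl_injective.encard_image, Set.encard_univ]
              simp
          _ ≤ _ := Set.encard_le_encard (by rintro _ ⟨j, rfl⟩; exact ⟨Nat.zero_le _, j.2⟩)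
      · rintro (j | ⟨j, v⟩) - h
        · exact Bool.eq_not.2 (hne j)
        · simp only [x', Sum.elim_inr] at h
          omega
    have hinj_j : Function.Injective fun v : V => (Sum.inr (j, v) : Fin m ⊕ Fin m × V) :=
      fun v v' h => by simpa using h
    rcases hcol fun v => c (Sum.inr (j, v)) with ⟨a, b, hab, col', hmono⟩ | hquad
    · -- A monochromatic strip in a copy is one in the whole forest.
      have hiff : ∀ w, (m + (j * K + a) ≤ x' w ∧ x' w < m + (j * K + min b K)) ↔
          ∃ v, Sum.inr (j, v) = w ∧ a ≤ x v ∧ x v < b := by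
        intro w
        constructor
        · rintro ⟨h1, h2⟩
          obtain j' | ⟨j', v⟩ := w
          · have := j'.2
            simp only [x', Sum.elim_inl] at h1
            omega
          · simp only [x', Sum.elim_inr] at h1 h2
            have hx := (hlt v).1
            obtain rfl : j = j' := Fin.ext (le_antisymm
              (le_of_mul_add_le_mul_add hx (by omega : (j : ℕ) * K + a ≤ j' * K + x v))
              (le_of_mul_add_le_mul_add (r := x v) (r' := min b K - 1)
                (by omega) (by omega : (j' : ℕ) * K + x v ≤ j * K + (min b K - 1))))
            exact ⟨v, rfl, by omega, by omega⟩
        · rintro ⟨v, rfl, h1, h2⟩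
          have hx := (hlt v).1
          simp only [x', Sum.elim_inr]
          omega
      refine absurd ⟨m + (j * K + a), m + (j * K + min b K), ?_, col', fun w h1 h2 => ?_⟩ hstrip
      · rw [← hinj_j.encard_image] at hab
        refine hab.trans (Set.encard_le_encard ?_)
        rintro _ ⟨v, hv, rfl⟩
        exact (hiff _).2 ⟨v, rfl, hv⟩
      · obtain ⟨v, rfl, h3, h4⟩ := (hiff w).1 ⟨h1, h2⟩
        exact hmono v h3 h4
    · -- A quadrant in the copy below root `j` picks up that root, and nothing else.
      obtain ⟨i₁, i₂, hi₁, hi₂, hcard, hmono⟩ := hquad col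
      have hiff : ∀ w, (j * (K + 1) + i₁ ≤ y' w ∧ (m - 1 - j) * (K + 1) + i₂ ≤ z' w) ↔
          w = Sum.inl j ∨ ∃ v, Sum.inr (j, v) = w ∧ i₁ ≤ y v ∧ i₂ ≤ z v := by
        intro w
        constructor
        · rintro ⟨h1, h2⟩
          have hjm := j.2
          obtain j' | ⟨j', v⟩ := w
          · simp only [y', z', Sum.elim_inl] at h1 h2
            have h3 := le_of_mul_add_le_mul_add (Nat.lt_add_one K) h1
            have h4 := le_of_mul_add_le_mul_add (Nat.lt_add_one K) h2
            have hjm' := j'.2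
            exact Or.inl (congrArg Sum.inl (Fin.ext (by omega)))
          · simp only [y', z', Sum.elim_inr] at h1 h2
            obtain ⟨-, hy, hz⟩ := hlt v
            have h3 := le_of_mul_add_le_mul_add (hy.trans (Nat.lt_add_one K)) h1
            have h4 := le_of_mul_add_le_mul_add (hz.trans (Nat.lt_add_one K)) h2
            have hjm' := j'.2
            obtain rfl : j = j' := Fin.ext (by omega)
            exact Or.inr ⟨v, rfl, by omega, by omega⟩
        · rintro (rfl | ⟨v, rfl, h1, h2⟩)
          · simp only [y', z', Sum.elim_inl]
            omega
          · simp only [y', z', Sum.elim_inr]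
            omega
      have hbound : (j : ℕ) * (K + 1) + i₁ ≤ m + m * (K + 1) ∧
          (m - 1 - j) * (K + 1) + i₂ ≤ m + m * (K + 1) := by
        have h1 := mul_add_lt_mul j.2 (Nat.lt_add_one_of_le hi₁)
        have h2 := mul_add_lt_mul (show m - 1 - (j : ℕ) < m by omega) (Nat.lt_add_one_of_le hi₂)
        omega
      refine ⟨_, _, hbound.1, hbound.2, ?_, fun w h1 h2 => ?_⟩
      · rw [← hinj_j.encard_image] at hcard
        rw [Nat.cast_succ]
        calc (n : ℕ∞) + 1 ≤ _ + 1 := by gcongr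
          _ = (insert (Sum.inl j) _ : Set (Fin m ⊕ Fin m × V)).encard :=
            (Set.encard_insert_of_notMem (by simp)).symm
          _ ≤ _ := Set.encard_le_encard (by
            rintro w (rfl | ⟨v, hv, rfl⟩)
            · exact (hiff _).2 (Or.inl rfl)
            · exact (hiff _).2 (Or.inr ⟨v, rfl, hv⟩))
      · obtain rfl | ⟨v, rfl, h3, h4⟩ := (hiff w).1 ⟨h1, h2⟩
        · exact hj
        · exact hmono v h3 h4

theorem pow_mul_pow_dvd_pow_mul_pow_iff {p q : ℕ} (hp : 2 ≤ p) (hq : 2 ≤ q)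
    (hpq : Nat.Coprime p q) {i j y z : ℕ} :
    p ^ i * q ^ j ∣ p ^ y * q ^ z ↔ i ≤ y ∧ j ≤ z := by
  constructor
  · intro h
    constructor
    · exact (Nat.pow_dvd_pow_iff_le_right hp).1
        ((Nat.Coprime.pow i z hpq).dvd_of_dvd_mul_right ((Dvd.intro _ rfl).trans h))
    · exact (Nat.pow_dvd_pow_iff_le_right hq).1
        ((Nat.Coprime.pow j y hpq.symm).dvd_of_dvd_mul_left ((Dvd.intro_left _ rfl).trans h))
  · rintro ⟨h1, h2⟩
    exact mul_dvd_mul (pow_dvd_pow p h1) (pow_dvd_pow q h2)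

/-- The hypergraph on the set `S` of natural numbers with all traces of the progressions allowed by `D` and `M`. -/
def apOn (D M S : Set ℕ) : Hypergraph ℕ where
  vertexSet := S
  edgeSet := {e | ∃ P ∈ finiteProgressions D M, e = P ∩ S}
  subset_vertexSet_of_mem_edgeSet' := by
    rintro e ⟨P, -, rfl⟩ x hx
    exact hx.2

theorem mParam_apFamily_eq_top {p q k : ℕ} (hp : 2 ≤ p) (hq : 2 ≤ q) (hpq : Nat.Coprime p q)
    (hk : 2 ≤ k) : mParam (apFamily {d | ∃ i j : ℕ, d = p ^ i * q ^ j} {0}) k = ⊤ := by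
  rw [mParam, sInf_eq_top]
  rintro _ ⟨m, rfl, hm, hall⟩
  exfalso
  obtain ⟨V, hV, x, y, z, K, hinj, hlt, hcol⟩ := exists_forest hm m
  -- The point `v` becomes a number with valuations `y v` and `z v` at `p` and `q`; adding a
  -- multiple of `Q = p ^ K * q ^ K` does not change them, and puts the numbers in the order of `x`.
  set Q := p ^ K * q ^ K with hQ
  let g : V → ℕ := fun v => p ^ y v * q ^ z v + x v * Q
  have hp0 : 0 < p := by omega
  have hq0 : 0 < q := by omega
  have hsmall : ∀ v, p ^ y v * q ^ z v < Q := fun v =>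
    Nat.mul_lt_mul'' (Nat.pow_lt_pow_right hp (hlt v).2.1) (Nat.pow_lt_pow_right hq (hlt v).2.2)
  have hQ0 : 0 < Q := by positivity
  have hdiv : ∀ v, g v / Q = x v := fun v => by
    simp only [g]
    rw [Nat.add_mul_div_right _ _ hQ0, Nat.div_eq_of_lt (hsmall v), zero_add]
  have hg : Function.Injective g := fun v w h => hinj (by rw [← hdiv v, ← hdiv w, h])
  have hdvd : ∀ v i j, i ≤ K → j ≤ K → (p ^ i * q ^ j ∣ g v ↔ i ≤ y v ∧ j ≤ z v) := by
    intro v i j hi hj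
    rw [← pow_mul_pow_dvd_pow_mul_pow_iff hp hq hpq]
    exact Nat.dvd_add_left
      (((mul_dvd_mul (pow_dvd_pow p hi) (pow_dvd_pow q hj))).mul_left (x v))
  obtain ⟨c, hc⟩ := hall (apOn _ _ (Set.range g)) ⟨Set.finite_range g, fun e he => he⟩
  -- Every large edge contains vertices of colour `0` and vertices of another colour.
  have hbad : ∀ (P : Set ℕ) (s : Set V) (col : Bool),
      P ∈ finiteProgressions {d | ∃ i j : ℕ, d = p ^ i * q ^ j} {0} →
      (∀ v, g v ∈ P ↔ v ∈ s) → (m : ℕ∞) ≤ s.encard →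
      ¬ ∀ v ∈ s, decide (c ⟨g v, v, rfl⟩ = ⟨0, by omega⟩) = col := by
    intro P s col hP hPs hs hmono
    have himg : P ∩ Set.range g = g '' s := by
      ext w
      constructor
      · rintro ⟨h, v, rfl⟩
        exact ⟨v, (hPs v).1 h, rfl⟩
      · rintro ⟨v, hv, rfl⟩
        exact ⟨(hPs v).2 hv, v, rfl⟩
    have hpoly := hc (P ∩ Set.range g) ⟨⟨P, hP, rfl⟩, by rwa [himg, hg.encard_image]⟩
    cases col with
    | true =>
      obtain ⟨⟨_, v, rfl⟩, hv, hvc⟩ := hpoly ⟨1, by omega⟩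
      have := hmono v ((hPs v).1 hv.1)
      rw [hvc] at this
      simp at this
    | false =>
      obtain ⟨⟨_, v, rfl⟩, hv, hvc⟩ := hpoly ⟨0, by omega⟩
      have := hmono v ((hPs v).1 hv.1)
      rw [hvc] at this
      simp at this
  rcases hcol fun v => decide (c ⟨g v, v, rfl⟩ = ⟨0, by omega⟩) with
    ⟨a, b, hcard, col, hmono⟩ | hquad
  · have hab : a < b := by
      obtain ⟨v, hv⟩ := Set.encard_ne_zero.1
        (ne_of_gt (lt_of_lt_of_le (by exact_mod_cast hm) hcard))
      exact hv.1.trans_lt hv.2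
    have hpos : 0 < (b - a) * Q := Nat.mul_pos (by omega) hQ0
    refine hbad {w | ∃ l < (b - a) * Q, w = a * Q + l * 1} {v | a ≤ x v ∧ x v < b} col
      ⟨a * Q, 1, (b - a) * Q, ⟨0, 0, by simp⟩, hpos, ⟨a * Q, 0, rfl, by simp⟩, rfl⟩ ?_ hcard
      fun v hv => hmono v hv.1 hv.2
    intro v
    have h1 : a ≤ x v ↔ a * Q ≤ g v := by rw [← hdiv v, Nat.le_div_iff_mul_le hQ0]
    have h2 : x v < b ↔ g v < b * Q := by rw [← hdiv v, Nat.div_lt_iff_lt_mul hQ0]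
    have h3 : (b - a) * Q + a * Q = b * Q := by rw [← add_mul, Nat.sub_add_cancel hab.le]
    simp only [Set.mem_ofPred_eq, h1, h2, mul_one]
    constructor
    · rintro ⟨l, hl, h⟩
      omega
    · rintro ⟨h4, h5⟩
      exact ⟨g v - a * Q, by omega, by omega⟩
  · obtain ⟨i, j, hi, hj, hcard, hmono⟩ := hquad true
    have hd : 0 < p ^ i * q ^ j := by positivity
    refine hbad {w | ∃ l < K * Q + 1, w = 0 + l * (p ^ i * q ^ j)} {v | i ≤ y v ∧ j ≤ z v} true
      ⟨0, p ^ i * q ^ j, K * Q + 1, ⟨i, j, rfl⟩, Nat.succ_pos _, ⟨0, 0, rfl, by simp⟩, rfl⟩ ?_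
      hcard fun v hv => hmono v hv.1 hv.2
    intro v
    rw [Set.mem_ofPred_eq (p := fun v => i ≤ y v ∧ j ≤ z v), ← hdvd v i j hi hj]
    constructor
    · rintro ⟨l, -, h⟩
      exact ⟨l, by rw [h]; ring⟩
    · rintro ⟨l, h⟩
      refine ⟨l, ?_, by rw [h]; ring⟩
      have h1 : g v < K * Q := by
        have := mul_add_lt_mul (hlt v).1 (hsmall v)
        simp only [g]
        omega
      have h2 : l ≤ g v := by
        rw [h]
        exact Nat.le_mul_of_pos_left l hd
      omega

end Polychromatic

theorem theorem7 :
    (∀ (t k : ℕ) (M : Set ℕ), 0 < t → 0 < k →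
      (∀ a ∈ M, ∀ b ∈ M, a ≡ b [MOD t] → a = b) →
      Polychromatic.mParam (Polychromatic.apFamily {d | ∃ i : ℕ, d = t ^ i} M) k ≤
        M.encard * (Polychromatic.mParam Polychromatic.bottomless k - 1) + 1) ∧
    (∀ p q k : ℕ, 2 ≤ p → 2 ≤ q → Nat.Coprime p q → 2 ≤ k →
      Polychromatic.mParam (Polychromatic.apFamily {d | ∃ i j : ℕ, d = p ^ i * q ^ j} {0}) k =
        ⊤) :=
  ⟨fun _ _ _ ht hk hM => Polychromatic.mParam_apFamily_le ht hk hM,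
    fun _ _ _ hp hq hpq hk => Polychromatic.mParam_apFamily_eq_top hp hq hpq hk⟩
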